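/- Let $H$ be a finite abelian group, written additively. A finite family of triples of subsets $A_i,B_i,C_i\subseteq H$ is an STPP construction in $H$ if (1) for each $i$, and for all $a,a'\in A_i$, $b,b'\in B_i$, $c,c'\in C_i$, one has $(a'-a)+(b'-b)+(c'-c)=0$ if and only if $a=a'$, $b=b'$ and $c=c'$; and (2) for all $i,j,k$, if $s+t+u=0$ with $s\in A_i-B_i$, $t\in B_j-C_j$, $u\in C_k-A_k$, then $i=j=k$. Such a construction implies, for the exponent $\omega\ge 2$ of matrix multiplication, the inequality $$\sum_i (|A_i||B_i||C_i|)^{\omega/3}\le |H|.\qquad(*)$$ Say that the construction yields the bound $\omega\le c$ via $(*)$ if every real number $w\ge 2$ with $\sum_i (|A_i||B_i||C_i|)^{w/3}\le |H|$ satisfies $w\le c$. Theorem. For every $\ell\in\mathbb N$ there is an $\varepsilon_\ell>0$ such that no STPP construction in any finite abelian group $H$ of exponent at most $\ell$ yields a bound $\omega\le c$ with $c<2+\varepsilon_\ell$ via the inequality $(*)$. -/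

import Mathlib

/-- The triple product property for subsets `A, B, C` of an abelian group (additive notation):
for `x ∈ A - A`, `y ∈ B - B`, `z ∈ C - C`, one has `x + y + z = 0` iff `x = y = z = 0`. -/
def TripleProductProperty {H : Type*} [AddCommGroup H] (A B C : Finset H) : Prop :=
  ∀ a ∈ A, ∀ a' ∈ A, ∀ b ∈ B, ∀ b' ∈ B, ∀ c ∈ C, ∀ c' ∈ C,
    ((a' - a) + (b' - b) + (c' - c) = 0 ↔ a' - a = 0 ∧ b' - b = 0 ∧ c' - c = 0)

/-- A family of triples `(A i, B i, C i)` of subsets of an abelian group is an STPP construction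
if it satisfies the simultaneous triple product property. -/
structure IsSTPP {H : Type*} [AddCommGroup H] {ι : Type*} (A B C : ι → Finset H) : Prop where
  /-- Each triple satisfies the triple product property. -/
  tpp : ∀ i, TripleProductProperty (A i) (B i) (C i)
  /-- If `s + t + u = 0` with `s ∈ A i - B i`, `t ∈ B j - C j`, `u ∈ C k - A k`,
  then `i = j = k`. -/
  simultaneous : ∀ i j k, ∀ a ∈ A i, ∀ b ∈ B i, ∀ b' ∈ B j, ∀ c ∈ C j, ∀ c' ∈ C k, ∀ a' ∈ A k,
    (a - b) + (b' - c) + (c' - a') = 0 → i = j ∧ j = k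

/-- The inequality `∑ i, (|A i| |B i| |C i|) ^ (w / 3) ≤ |H|` in the unknown real exponent `w`. -/
def STPPInequality {H : Type*} {ι : Type*} [Fintype ι] (A B C : ι → Finset H) (w : ℝ) : Prop :=
  ∑ i, (((A i).card * (B i).card * (C i).card : ℕ) : ℝ) ^ (w / 3) ≤ (Nat.card H : ℝ)

/-- The triples yield the bound `ω ≤ c` via the inequality: among the a priori possible values
`w ≥ 2` of the exponent of matrix multiplication, the inequality leaves only values `w ≤ c`. -/
def YieldsOmegaBound {H : Type*} {ι : Type*} [Fintype ι] (A B C : ι → Finset H) (c : ℝ) : Prop :=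
  ∀ w : ℝ, 2 ≤ w → STPPInequality A B C w → w ≤ c

/-! An STPP construction is a disguised tricolored sum-free set, and in bounded exponent these have
size at most `3 |G| ^ (1 - δ)` by slice rank (`exists_tricoloredSumFree_bound`). If all the sets
have size `n`, a Ruzsa–Szemerédi system of about `n ^ (2 - η)` triples turns the construction into
such a set (`IsSTPP.exists_isTricoloredSumFree`). In general, pass to the `N`-th power, keep one
type of index so that the sizes are constants `P, Q, R`, and multiply with the two cyclic rotations
so that every set has size `n = PQR` in `G = H ^ (3N)`. With `t` indices kept, `t ^ 3 * n ^ (2 - η)`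
is at most a constant times `|G| ^ (1 - δ)`. Since `n ≤ |G|` and `2η ≤ δ`, the saving pays for a
further factor `n ^ (2η)` (`IsSTPP.sum_rpow_pow_le`). Letting `N` grow removes constants and
polynomial factors: `w = 2 + η` itself satisfies the inequality, so no smaller bound follows. -/

/-! ### Slice rank of the diagonal tensor -/

open Finset in
/-- A subspace of functions contains a function whose support is at least as large as the
dimension of the subspace. -/
theorem exists_mem_finrank_le_card_support {F T : Type*} [Field F] [DecidableEq F] [Fintype T]
    (V : Submodule F (T → F)) :
    ∃ h ∈ V, Module.finrank F V ≤ #{i | h i ≠ 0} := by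
  classical
  obtain ⟨h, hV, hmax⟩ : ∃ h ∈ V, ∀ g ∈ V, #{i | g i ≠ 0} ≤ #{i | h i ≠ 0} := by
    let P : ℕ → Prop := fun n => ∃ h ∈ V, #{i | h i ≠ 0} = n
    have hP : P #{i | (0 : T → F) i ≠ 0} := ⟨0, V.zero_mem, rfl⟩
    have hb : ∀ n, P n → n ≤ Fintype.card T := by
      rintro n ⟨h, -, rfl⟩
      exact card_le_univ _
    obtain ⟨h, hV, hh⟩ := Nat.findGreatest_spec (hb _ hP) hP
    refine ⟨h, hV, fun g hg => ?_⟩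
    rw [hh]
    exact Nat.le_findGreatest (hb _ ⟨g, hg, rfl⟩) ⟨g, hg, rfl⟩
  refine ⟨h, hV, ?_⟩
  -- Otherwise restriction to the support of `h` kills some nonzero `v ∈ V`, and `h + v` has larger
  -- support.
  by_contra! hlt
  let S : Finset T := {i | h i ≠ 0}
  let L : V →ₗ[F] (S → F) := (LinearMap.funLeft F F (fun i : S => (i : T))) ∘ₗ V.subtype
  have hker : L.ker ≠ ⊥ := by
    apply LinearMap.ker_ne_bot_of_finrank_lt
    rw [Module.finrank_fintype_fun_eq_card, Fintype.card_coe]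
    exact hlt
  obtain ⟨v, hv, hv0⟩ := Submodule.exists_mem_ne_zero_of_ne_bot hker
  have hvS : ∀ i, h i ≠ 0 → (v : T → F) i = 0 := fun i hi => by
    have := congrFun (LinearMap.mem_ker.1 hv) ⟨i, by simpa [S] using hi⟩
    simpa [L, LinearMap.funLeft] using this
  obtain ⟨j, hj⟩ : ∃ j, (v : T → F) j ≠ 0 := by
    by_contra! hall
    exact hv0 (Subtype.ext (funext hall))
  have hhj : h j = 0 := by
    by_contra hne
    exact hj (hvS j hne)
  have hlt' : #{i | h i ≠ 0} < #{i | (h + v : T → F) i ≠ 0} := by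
    apply card_lt_card
    rw [ssubset_iff_of_subset]
    · exact ⟨j, by simp [hhj, hj], by simp [hhj]⟩
    · intro i hi
      have hi' : h i ≠ 0 := by simpa using hi
      simp [hvS i hi', hi']
  exact absurd (hmax _ (V.add_mem hV v.2)) (not_le.2 hlt')

open Finset Matrix in
/-- The slice rank of the diagonal tensor on `T × T × T` is at least `|T|`. -/
theorem card_le_of_sum_slices {F T S₁ S₂ S₃ : Type*} [Field F] [Fintype T] [DecidableEq T]
    [Fintype S₁] [Fintype S₂] [Fintype S₃]
    (f₁ : S₁ → T → F) (g₁ : S₁ → T → T → F) (f₂ : S₂ → T → F) (g₂ : S₂ → T → T → F)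
    (f₃ : S₃ → T → F) (g₃ : S₃ → T → T → F)
    (h : ∀ i j k, (if i = j ∧ j = k then 1 else 0) =
      ∑ s, f₁ s i * g₁ s j k + ∑ s, f₂ s j * g₂ s i k + ∑ s, f₃ s k * g₃ s i j) :
    Fintype.card T ≤ Fintype.card S₁ + Fintype.card S₂ + Fintype.card S₃ := by
  classical
  -- Contracting the first index with a `v` orthogonal to every `f₁ s` removes the first family of
  -- slices and leaves a diagonal matrix of rank at most `|S₂| + |S₃|`.
  let L : (T → F) →ₗ[F] (S₁ → F) := (Matrix.of f₁).mulVecLin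
  obtain ⟨v, hv, hcard⟩ := exists_mem_finrank_le_card_support (LinearMap.ker L)
  have hker : Fintype.card T ≤ Fintype.card S₁ + Module.finrank F (LinearMap.ker L) := by
    have h1 := LinearMap.finrank_range_add_finrank_ker L
    have h2 := Submodule.finrank_le (LinearMap.range L)
    simp only [Module.finrank_fintype_fun_eq_card] at h1 h2
    omega
  have hv' : ∀ s, ∑ i, v i * f₁ s i = 0 := fun s => by
    have := congrFun (LinearMap.mem_ker.1 hv) s
    simpa [L, Matrix.mulVec, dotProduct, mul_comm] using this
  have hdiag : Matrix.diagonal v =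
      (Matrix.of fun j s => f₂ s j) * (Matrix.of fun s k => ∑ i, v i * g₂ s i k) +
      (Matrix.of fun j s => ∑ i, v i * g₃ s i j) * (Matrix.of fun s k => f₃ s k) := by
    ext j k
    have h0 : ∑ i, v i * (if i = j ∧ j = k then (1 : F) else 0) = Matrix.diagonal v j k := by
      by_cases hjk : j = k <;> simp [hjk]
    rw [← h0]
    simp only [h, Matrix.add_apply, Matrix.mul_apply, Matrix.of_apply, mul_add, sum_add_distrib]
    have e1 : ∑ i, v i * ∑ s, f₁ s i * g₁ s j k = 0 := by
      simp only [mul_sum]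
      rw [sum_comm]
      refine sum_eq_zero fun s _ => ?_
      rw [← zero_mul (g₁ s j k), ← hv' s, sum_mul]
      exact sum_congr rfl fun i _ => by ring
    rw [e1, zero_add]
    congr 1
    · simp only [mul_sum]
      rw [sum_comm]
      exact sum_congr rfl fun s _ => sum_congr rfl fun i _ => by ring
    · simp only [mul_sum, sum_mul]
      rw [sum_comm]
      exact sum_congr rfl fun s _ => sum_congr rfl fun i _ => by ring
  have hrank : #{i | v i ≠ 0} ≤ Fintype.card S₂ + Fintype.card S₃ := by
    have h1 : (Matrix.diagonal v).rank = #{i | v i ≠ 0} := by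
      rw [Matrix.rank_diagonal, Fintype.card_subtype]
    rw [← h1, hdiag, ← Matrix.fromCols_mul_fromRows, ← Fintype.card_sum]
    exact (Matrix.rank_mul_le_left _ _).trans (Matrix.rank_le_card_width _)
  omega

/-! ### Tricolored sum-free sets and weighted expansions -/

/-- A family of triples `(x i, y i, z i)` in an abelian group is tricolored sum-free if
`x i + y j + z k` vanishes exactly when `i = j = k`. -/
def IsTricoloredSumFree {G T : Type*} [AddCommGroup G] (x y z : T → G) : Prop :=
  ∀ i j k, x i + y j + z k = 0 ↔ i = j ∧ j = k

-- Each nonzero term goes to the first of its three indices satisfying `P`, which gives three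
-- families of slices indexed by `P`.
open Finset in
theorem IsTricoloredSumFree.card_le_of_expansion {G T F E : Type*} [AddCommGroup G] [DecidableEq G]
    [Fintype T] [Field F] [Fintype E] {x y z : T → G} (hT : IsTricoloredSumFree x y z)
    (φ : E → G → F) (c : E → E → E → F)
    (hφ : ∀ x y z, (if x + y + z = 0 then 1 else 0) =
      ∑ a, ∑ b, ∑ d, c a b d * (φ a x * φ b y * φ d z))
    (P : E → Prop) [DecidablePred P] (hP : ∀ a b d, c a b d ≠ 0 → P a ∨ P b ∨ P d) :
    Fintype.card T ≤ 3 * #{a | P a} := by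
  classical
  have key := card_le_of_sum_slices (F := F) (T := T) (S₁ := {a // P a}) (S₂ := {a // P a})
    (S₃ := {a // P a})
    (fun a i => φ a (x i)) (fun a j k => ∑ b, ∑ d, c a b d * (φ b (y j) * φ d (z k)))
    (fun b j => φ b (y j))
    (fun b i k => ∑ a, ∑ d, if P a then 0 else c a b d * (φ a (x i) * φ d (z k)))
    (fun d k => φ d (z k))
    (fun d i j => ∑ a, ∑ b, if P a ∨ P b then 0 else c a b d * (φ a (x i) * φ b (y j))) ?_
  · rw [Fintype.card_subtype] at key
    omega
  intro i j k
  have hsub : ∀ f : E → F, ∑ a : {a // P a}, f a = ∑ a, if P a then f a else 0 := fun f => by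
    rw [← sum_filter]
    exact (sum_subtype _ (by simp) f).symm
  rw [hsub (fun a => φ a (x i) * ∑ b, ∑ d, c a b d * (φ b (y j) * φ d (z k))),
    hsub (fun b => φ b (y j) *
      ∑ a, ∑ d, if P a then 0 else c a b d * (φ a (x i) * φ d (z k))),
    hsub (fun d => φ d (z k) *
      ∑ a, ∑ b, if P a ∨ P b then 0 else c a b d * (φ a (x i) * φ b (y j)))]
  have e1 : (∑ a, if P a then φ a (x i) * ∑ b, ∑ d, c a b d * (φ b (y j) * φ d (z k)) else 0) =
      ∑ a, ∑ b, ∑ d, if P a then c a b d * (φ a (x i) * φ b (y j) * φ d (z k)) else 0 := by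
    refine sum_congr rfl fun a _ => ?_
    split_ifs
    · simp only [mul_sum]
      exact sum_congr rfl fun b _ => sum_congr rfl fun d _ => by ring
    · simp
  have e2 : (∑ b, if P b then φ b (y j) *
      ∑ a, ∑ d, if P a then 0 else c a b d * (φ a (x i) * φ d (z k)) else 0) =
      ∑ a, ∑ b, ∑ d, if P a then 0 else if P b then
        c a b d * (φ a (x i) * φ b (y j) * φ d (z k)) else 0 := by
    rw [sum_comm (s := univ (α := E))]
    refine sum_congr rfl fun b _ => ?_
    split_ifs
    · simp only [mul_sum]
      exact sum_congr rfl fun a _ => sum_congr rfl fun d _ => by split_ifs <;> ring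
    · simp
  have e3 : (∑ d, if P d then φ d (z k) *
      ∑ a, ∑ b, if P a ∨ P b then 0 else c a b d * (φ a (x i) * φ b (y j)) else 0) =
      ∑ a, ∑ b, ∑ d, if P a ∨ P b then 0 else if P d then
        c a b d * (φ a (x i) * φ b (y j) * φ d (z k)) else 0 := by
    have : ∀ f : E → E → E → F, ∑ a, ∑ b, ∑ d, f a b d = ∑ d, ∑ a, ∑ b, f a b d := fun f => by
      rw [sum_comm (s := univ (α := E)) (f := fun d a => ∑ b, f a b d)]
      exact sum_congr rfl fun a _ => sum_comm
    rw [this]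
    refine sum_congr rfl fun d _ => ?_
    split_ifs
    · simp only [mul_sum]
      exact sum_congr rfl fun a _ => sum_congr rfl fun b _ => by split_ifs <;> ring
    · simp
  rw [e1, e2, e3, ← if_congr (hT i j k) rfl rfl, hφ]
  simp only [← sum_add_distrib]
  refine sum_congr rfl fun a _ => sum_congr rfl fun b _ => sum_congr rfl fun d _ => ?_
  by_cases hc : c a b d = 0
  · simp [hc]
  · have h := hP a b d hc
    by_cases ha : P a
    · simp only [ha, true_or, if_true, add_zero]
    by_cases hb : P b
    · simp only [ha, hb, false_or, if_true, if_false, add_zero, zero_add]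
    · simp only [ha, hb, false_or] at h
      simp only [ha, hb, h, false_or, if_true, if_false, zero_add]

open Finset in
/-- Chernoff's bound for the number of elements of a product with below-average weight. -/
theorem card_filter_sum_le_prod_sum_exp {I : Type*} [Fintype I] [DecidableEq I] {E : I → Type*}
    [∀ i, Fintype (E i)] (w : ∀ i, E i → ℝ) (t : ℝ) (r : I → ℝ) (ht : 0 ≤ t) :
    (#{a : ∀ i, E i | ∑ i, w i (a i) ≤ ∑ i, r i} : ℝ) ≤
      ∏ i, ∑ a, Real.exp (t * (r i - w i a)) := by
  classical
  rw [prod_univ_sum, Fintype.piFinset_univ, card_eq_sum_ones, Nat.cast_sum]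
  refine (sum_le_sum fun a ha => ?_).trans
    (sum_le_sum_of_subset_of_nonneg (filter_subset _ _) fun a _ _ => by positivity)
  rw [← Real.exp_sum, ← mul_sum, sum_sub_distrib, Nat.cast_one]
  have : ∑ i, w i (a i) ≤ ∑ i, r i := by simpa using ha
  exact Real.one_le_exp (mul_nonneg ht (by linarith))

-- Tensor the expansions of the factors. The three total weights of a nonzero term add up to at most
-- `|I|`, so one is at most `|I| / 3`; Chernoff's bound counts such indices.
open Finset in
theorem IsTricoloredSumFree.card_le_prod {I T F : Type*} [Fintype I] [DecidableEq I]
    [Field F] [Fintype T] {G : I → Type*} [∀ i, AddCommGroup (G i)] [∀ i, DecidableEq (G i)]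
    {E : I → Type*} [∀ i, Fintype (E i)]
    {x y z : T → ∀ i, G i} (hT : IsTricoloredSumFree x y z)
    (φ : ∀ i, E i → G i → F) (c : ∀ i, E i → E i → E i → F)
    (hφ : ∀ i x y z, (if x + y + z = 0 then 1 else 0) =
      ∑ a, ∑ b, ∑ d, c i a b d * (φ i a x * φ i b y * φ i d z))
    (w : ∀ i, E i → ℝ) (hw : ∀ i a b d, c i a b d ≠ 0 → w i a + w i b + w i d ≤ 1)
    (t : ℝ) (ht : 0 ≤ t) :
    (Fintype.card T : ℝ) ≤ 3 * ∏ i, ∑ a, Real.exp (t * (1 / 3 - w i a)) := by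
  classical
  refine le_trans ?_ (mul_le_mul_of_nonneg_left
    (card_filter_sum_le_prod_sum_exp w t (fun _ => 1 / 3) ht) (by norm_num))
  have := hT.card_le_of_expansion (E := ∀ i, E i) (fun a x => ∏ i, φ i (a i) (x i))
    (fun a b d => ∏ i, c i (a i) (b i) (d i)) ?_
    (fun a => ∑ i, w i (a i) ≤ ∑ i : I, (1 / 3 : ℝ)) ?_
  · exact_mod_cast this
  · intro x y z
    have h0 : (if x + y + z = 0 then (1 : F) else 0) =
        ∏ i, if x i + y i + z i = 0 then 1 else 0 := by
      rw [prod_ite_zero]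
      simp [funext_iff]
    rw [h0]
    simp only [hφ, prod_univ_sum, Fintype.piFinset_univ, prod_mul_distrib]
  · intro a b d h
    rw [prod_ne_zero_iff] at h
    by_contra! hc
    have h1 := sum_le_sum fun i (_ : i ∈ univ) => hw i _ _ _ (h i (mem_univ i))
    simp only [sum_add_distrib] at h1
    have h2 : ∑ i : I, (1 : ℝ) = 3 * ∑ i : I, (1 / 3 : ℝ) := by simp; ring
    linarith [hc.1, hc.2.1, hc.2.2]

/-! ### Expansions on cyclic groups of prime power order -/

open Finset in
/-- Over a field of characteristic `p`, the tensor `[x + y + z = 0]` on `ZMod (p ^ e)` is a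
combination of products of basis functions of total degree less than `p ^ e`. -/
theorem exists_expansion_zmod_prime_pow (p e : ℕ) [Fact p.Prime] :
    ∃ (φ : Fin (p ^ e) → ZMod (p ^ e) → ZMod p)
      (c : Fin (p ^ e) → Fin (p ^ e) → Fin (p ^ e) → ZMod p),
      (∀ x y z, (if x + y + z = 0 then 1 else 0) =
        ∑ a, ∑ b, ∑ d, c a b d * (φ a x * φ b y * φ d z)) ∧
      ∀ a b d, c a b d ≠ 0 → (a + b + d : ℕ) < p ^ e := by
  classical
  have hp : p.Prime := Fact.out
  have : NeZero (p ^ e) := ⟨(pow_pos hp.pos e).ne'⟩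
  -- The tensor is the coefficient at `0` of `Y ^ x * Y ^ y * Y ^ z` in the group algebra. Expand
  -- each power in `Y - 1`, where `(Y - 1) ^ (p ^ e) = 0` by Frobenius.
  let R := AddMonoidAlgebra (ZMod p) (ZMod (p ^ e))
  have : CharP R p := charP_of_injective_algebraMap (algebraMap (ZMod p) R).injective p
  let Y : R := AddMonoidAlgebra.single 1 1
  have hY : ∀ n : ℕ, Y ^ n = AddMonoidAlgebra.single (n : ZMod (p ^ e)) 1 := fun n => by
    rw [AddMonoidAlgebra.single_pow, one_pow, nsmul_eq_mul, mul_one]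
  have hX : (Y - 1) ^ (p ^ e) = 0 := by
    rw [sub_pow_char_pow, hY, one_pow, AddMonoidAlgebra.one_def, ZMod.natCast_self, sub_self]
  have hsingle : ∀ x : ZMod (p ^ e), (AddMonoidAlgebra.single x 1 : R) =
      ∑ a : Fin (p ^ e), ((x.val.choose a : ℕ) : ZMod p) • (Y - 1) ^ (a : ℕ) := fun x => by
    have h1 : (AddMonoidAlgebra.single x 1 : R) = ((Y - 1) + 1) ^ x.val := by
      rw [sub_add_cancel, hY, ZMod.natCast_zmod_val]
    rw [h1, add_pow, Fin.sum_univ_eq_sum_range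
      (fun a => ((x.val.choose a : ℕ) : ZMod p) • (Y - 1) ^ a)]
    have h2 : range (x.val + 1) ⊆ range (p ^ e) := range_subset_range.2 (ZMod.val_lt x)
    rw [← sum_subset h2]
    · refine sum_congr rfl fun a _ => ?_
      rw [one_pow, mul_one, Nat.cast_smul_eq_nsmul, nsmul_eq_mul, mul_comm]
    · intro a _ ha
      rw [Nat.choose_eq_zero_of_lt (by simpa using ha), Nat.cast_zero, zero_smul]
  refine ⟨fun a x => ((x.val.choose a : ℕ) : ZMod p),
    fun a b d => ((Y - 1) ^ ((a : ℕ) + b + d)).coeff 0, fun x y z => ?_, fun a b d h => ?_⟩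
  · have h1 : (if x + y + z = 0 then (1 : ZMod p) else 0) =
        (AddMonoidAlgebra.single x 1 * AddMonoidAlgebra.single y 1 *
          AddMonoidAlgebra.single z 1 : R).coeff 0 := by
      rw [AddMonoidAlgebra.single_mul_single, AddMonoidAlgebra.single_mul_single,
        AddMonoidAlgebra.coeff_single, Finsupp.single_apply]
      simp
    rw [h1, hsingle x, hsingle y, hsingle z]
    simp only [sum_mul, mul_sum, smul_mul_smul_comm, ← pow_add, AddMonoidAlgebra.coeff_sum,
      Finsupp.finsetSum_apply, AddMonoidAlgebra.coeff_smul_apply, smul_eq_mul]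
    rw [sum_comm_cycle]
    refine (sum_congr rfl fun a _ => sum_comm.trans ?_)
    exact sum_congr rfl fun b _ => sum_congr rfl fun d _ => mul_comm _ _
  · by_contra! hle
    exact h (by beta_reduce; rw [pow_eq_zero_of_le hle hX, AddMonoidAlgebra.coeff_zero, Finsupp.zero_apply])

open Finset in
theorem exists_expansion_indicator (G F : Type*) [AddCommGroup G] [Fintype G] [DecidableEq G]
    [Field F] :
    ∃ (φ : G → G → F) (c : G → G → G → F),
      ∀ x y z, (if x + y + z = 0 then 1 else 0) =
        ∑ a, ∑ b, ∑ d, c a b d * (φ a x * φ b y * φ d z) :=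
  ⟨fun a x => if x = a then 1 else 0, fun a b d => if a + b + d = 0 then 1 else 0,
    fun x y z => by simp⟩

-- The weights average `1/2 > 1/3`, so the linear term gains `1/36`; the exponent is at most `1/9`
-- in absolute value, so the quadratic error is at most `1/81`, and `1 - 1/36 + 1/81 = 319/324`.
open Finset in
theorem sum_exp_le (q : ℕ) (hq : 2 ≤ q) :
    ∑ a : Fin q, Real.exp (1 / 6 * (1 / 3 - (a : ℝ) / (q - 1))) ≤ q * (319 / 324) := by
  have hq' : (2 : ℝ) ≤ q := by exact_mod_cast hq
  have hterm : ∀ a : Fin q, Real.exp (1 / 6 * (1 / 3 - (a : ℝ) / (q - 1))) ≤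
      1 + 1 / 6 * (1 / 3 - (a : ℝ) / (q - 1)) + 1 / 81 := fun a => by
    have ha : (a : ℝ) ≤ q - 1 := by
      have : (a : ℕ) + 1 ≤ q := a.2
      have : (a : ℝ) + 1 ≤ q := by exact_mod_cast this
      linarith
    have hu0 : 0 ≤ (a : ℝ) / (q - 1) := div_nonneg (by positivity) (by linarith)
    have hu1 : (a : ℝ) / (q - 1) ≤ 1 := (div_le_one (by linarith)).2 ha
    generalize (a : ℝ) / (q - 1) = u at hu0 hu1
    have h1 := Real.abs_exp_sub_one_sub_id_le (x := 1 / 6 * (1 / 3 - u))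
      (abs_le.2 ⟨by linarith, by linarith⟩)
    have h2 := (abs_le.1 h1).2
    nlinarith
  refine (sum_le_sum fun a _ => hterm a).trans ?_
  have hsum : ∑ a : Fin q, (a : ℝ) = q * (q - 1) / 2 := by
    rw [Fin.sum_univ_eq_sum_range (fun a => (a : ℝ))]
    have h := Finset.sum_range_id_mul_two q
    have h' : (∑ i ∈ range q, (i : ℝ)) * 2 = q * (q - 1) := by
      have : ((∑ i ∈ range q, i : ℕ) : ℝ) * 2 = q * ((q - 1 : ℕ) : ℝ) := by exact_mod_cast h
      rw [Nat.cast_sub (by omega)] at this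
      push_cast at this
      exact this
    linarith
  simp only [sum_add_distrib, ← mul_sum, sum_sub_distrib, ← sum_div, hsum]
  simp only [sum_const, card_univ, Fintype.card_fin, nsmul_eq_mul]
  have hne : (q : ℝ) - 1 ≠ 0 := by linarith
  field_simp
  linarith

open Finset in
/-- Each factor `ZMod (q ^ e)` has a weighted expansion over a field of characteristic `p`, with
an exponential gain when `q = p`. -/
theorem exists_weighted_expansion (p q e : ℕ) [Fact p.Prime] [Fact q.Prime] :
    ∃ (E : Type) (_ : Fintype E) (φ : E → ZMod (q ^ e) → ZMod p) (c : E → E → E → ZMod p)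
      (w : E → ℝ),
      (∀ x y z, (if x + y + z = 0 then 1 else 0) =
        ∑ a, ∑ b, ∑ d, c a b d * (φ a x * φ b y * φ d z)) ∧
      (∀ a b d, c a b d ≠ 0 → w a + w b + w d ≤ 1) ∧
      ∑ a, Real.exp (1 / 6 * (1 / 3 - w a)) ≤
        (q ^ e : ℕ) * (if e ≠ 0 ∧ q = p then 319 / 324 else 1) := by
  classical
  have hq : q.Prime := Fact.out
  by_cases h : e ≠ 0 ∧ q = p
  · obtain ⟨he, rfl⟩ := h
    obtain ⟨φ, c, h1, h2⟩ := exists_expansion_zmod_prime_pow q e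
    have hqe : 2 ≤ q ^ e := hq.two_le.trans (Nat.le_self_pow he q)
    have hqe' : (2 : ℝ) ≤ (q ^ e : ℕ) := by exact_mod_cast hqe
    refine ⟨Fin (q ^ e), inferInstance, φ, c, fun a => (a : ℝ) / ((q ^ e : ℕ) - 1), h1,
      fun a b d hc => ?_, ?_⟩
    · rw [← add_div, ← add_div, div_le_one (by linarith)]
      have := h2 a b d hc
      have : (a : ℕ) + b + d + 1 ≤ q ^ e := this
      have : ((a : ℕ) : ℝ) + (b : ℕ) + (d : ℕ) + 1 ≤ (q ^ e : ℕ) := by exact_mod_cast this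
      linarith
    · rw [if_pos ⟨he, rfl⟩]
      exact sum_exp_le _ hqe
  · have : NeZero (q ^ e) := ⟨(pow_pos hq.pos e).ne'⟩
    obtain ⟨φ, c, h1⟩ := exists_expansion_indicator (ZMod (q ^ e)) (ZMod p)
    -- Constant weight `1/3` makes every exponential `1`: neither gain nor loss.
    refine ⟨ZMod (q ^ e), inferInstance, φ, c, fun _ => 1 / 3, h1, fun _ _ _ _ => by norm_num, ?_⟩
    rw [if_neg h]
    simp [ZMod.card]

/-! ### Sum-free bound in groups of bounded exponent -/

theorem IsTricoloredSumFree.comp_addEquiv {G G' T : Type*} [AddCommGroup G] [AddCommGroup G']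
    {x y z : T → G} (h : IsTricoloredSumFree x y z) (e : G ≃+ G') :
    IsTricoloredSumFree (fun i => e (x i)) (fun i => e (y i)) (fun i => e (z i)) := fun i j k => by
  rw [← map_add, ← map_add, map_eq_zero_iff e e.injective]
  exact h i j k

theorem le_exponent_of_addEquiv_pi_zmod {G I : Type*} [AddCommGroup G] [Finite G] {n : I → ℕ}
    (e : G ≃+ ∀ i, ZMod (n i)) (i : I) : n i ≤ AddMonoid.exponent G := by
  classical
  have hpos : 0 < AddMonoid.exponent G :=
    Nat.pos_of_ne_zero AddMonoid.exponent_ne_zero_of_finite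
  refine Nat.le_of_dvd hpos ?_
  have h := AddMonoid.exponent_nsmul_eq_zero (e.symm (Pi.single i 1))
  rw [← map_nsmul, EmbeddingLike.map_eq_zero_iff] at h
  have := congrFun h i
  rw [Pi.smul_apply, Pi.single_eq_same, nsmul_eq_mul, mul_one, Pi.zero_apply] at this
  exact (ZMod.natCast_eq_zero_iff _ _).1 this

-- Pigeonhole over at most `L` primes: a single characteristic must serve a fixed fraction of the
-- cyclic factors.
open Finset in
theorem exists_prime_card_le_mul_card_fiber {I : Type*} (J : Finset I) (p : I → ℕ) (L : ℕ)
    (hp : ∀ i ∈ J, (p i).Prime) (hL : ∀ i ∈ J, p i ≤ L) :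
    ∃ r, r.Prime ∧ #J ≤ L * #{i ∈ J | p i = r} := by
  classical
  rcases J.eq_empty_or_nonempty with rfl | ⟨j, hj⟩
  · exact ⟨2, Nat.prime_two, by simp⟩
  have hcard : #J ≤ ∑ r ∈ J.image p, #{i ∈ J | p i = r} :=
    (card_eq_sum_card_fiberwise fun i hi => mem_image_of_mem p hi).le
  obtain ⟨r, hr, hmax⟩ := exists_max_image (J.image p) (fun r => #{i ∈ J | p i = r})
    ⟨_, mem_image_of_mem p hj⟩
  obtain ⟨i, hi, rfl⟩ := mem_image.1 hr
  refine ⟨p i, hp i hi, hcard.trans ((sum_le_card_nsmul _ _ _ hmax).trans ?_)⟩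
  rw [smul_eq_mul]
  refine Nat.mul_le_mul_right _ ?_
  have : J.image p ⊆ Icc 1 L := fun r hr => by
    obtain ⟨i, hi, rfl⟩ := mem_image.1 hr
    exact mem_Icc.2 ⟨(hp i hi).one_lt.le, hL i hi⟩
  simpa using card_le_card this

open Finset in
/-- Tricolored sum-free sets in abelian groups of bounded exponent are polynomially smaller than
the group. -/
theorem exists_tricoloredSumFree_bound (l : ℕ) :
    ∃ δ : ℝ, 0 < δ ∧ ∀ (G : Type*) [AddCommGroup G] [Finite G], AddMonoid.exponent G ≤ l →
      ∀ (T : Type*) [Fintype T] (x y z : T → G), IsTricoloredSumFree x y z →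
        (Fintype.card T : ℝ) ≤ 3 * (Nat.card G : ℝ) ^ (1 - δ) := by
  classical
  set L : ℕ := max l 2 with hLdef
  have hL2 : (2 : ℝ) ≤ L := by exact_mod_cast le_max_right l 2
  have hlogL : 0 < Real.log L := Real.log_pos (by linarith)
  have hκ : Real.log (319 / 324) < 0 := Real.log_neg (by norm_num) (by norm_num)
  -- With `n` factors gaining, `|G| ≤ L ^ (L * n)`; this `δ` makes `(319 / 324) ^ n ≤ |G| ^ (-δ)`.
  refine ⟨-Real.log (319 / 324) / (L * Real.log L), by
    apply div_pos (by linarith); positivity, ?_⟩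
  intro G _ _ hG T _ x y z hT
  obtain ⟨I, _, p, hp, e, ⟨f⟩⟩ := AddCommGroup.equiv_directSum_zmod_of_finite G
  let g : G ≃+ ∀ i, ZMod (p i ^ e i) := f.trans (DirectSum.addEquivProd _)
  have hprime : ∀ i, Fact (p i).Prime := fun i => ⟨hp i⟩
  have hq : ∀ i, p i ^ e i ≤ L := fun i =>
    ((le_exponent_of_addEquiv_pi_zmod g i).trans hG).trans (le_max_left _ _)
  have hcardG : (Nat.card G : ℝ) = ∏ i, ((p i ^ e i : ℕ) : ℝ) := by
    rw [Nat.card_congr g.toEquiv, Nat.card_pi]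
    simp only [Nat.card_zmod]
    push_cast
    rfl
  let J : Finset I := {i | e i ≠ 0}
  obtain ⟨r, hr, hJ⟩ := exists_prime_card_le_mul_card_fiber J p L (fun i _ => hp i)
    (fun i hi => (Nat.le_self_pow (by simpa [J] using hi) _).trans (hq i))
  have : Fact r.Prime := ⟨hr⟩
  choose E hE φ c w hφ hw hsum using fun i => exists_weighted_expansion r (p i) (e i)
  have hbound := (hT.comp_addEquiv g).card_le_prod φ c hφ w hw (1 / 6) (by norm_num)
  set n := #{i ∈ J | p i = r} with hn
  have hprod : ∏ i, ∑ a, Real.exp (1 / 6 * (1 / 3 - w i a)) ≤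
      Nat.card G * (319 / 324) ^ n := by
    refine (prod_le_prod (fun i _ => sum_nonneg fun a _ => (Real.exp_pos _).le)
      fun i _ => hsum i).trans ?_
    rw [prod_mul_distrib, ← hcardG, prod_ite, prod_const_one, mul_one, prod_const, hn,
      filter_filter]
  have hGpos : (0 : ℝ) < Nat.card G := by exact_mod_cast Nat.card_pos
  have hlog : Real.log (Nat.card G) ≤ L * n * Real.log L := by
    have h1 : (Nat.card G : ℝ) ≤ (L : ℝ) ^ #J := by
      rw [hcardG, ← prod_subset (subset_univ J)]
      · refine (prod_le_prod (fun i _ => by positivity) fun i _ =>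
          (Nat.cast_le (α := ℝ)).2 (hq i)).trans ?_
        rw [prod_const]
      · intro i _ hi
        have : e i = 0 := by simpa [J] using hi
        simp [this]
    refine (Real.log_le_log hGpos h1).trans ?_
    rw [Real.log_pow]
    refine mul_le_mul_of_nonneg_right ?_ hlogL.le
    exact_mod_cast hJ
  refine hbound.trans (mul_le_mul_of_nonneg_left (hprod.trans ?_) (by norm_num))
  rw [sub_eq_add_neg, Real.rpow_add hGpos, Real.rpow_one]
  refine mul_le_mul_of_nonneg_left ?_ hGpos.le
  rw [← Real.rpow_natCast, Real.rpow_def_of_pos (by norm_num), Real.rpow_def_of_pos hGpos,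
    Real.exp_le_exp]
  rw [← neg_div, neg_neg, ← mul_div_assoc, le_div_iff₀ (by positivity)]
  nlinarith

/-! ### Triangle systems from progression-free sets -/

/-- A set of triples such that no three of them overlap pairwise in different coordinates, i.e.
every triangle of the associated tripartite graph comes from a single triple. -/
def IsTriangleInduced {α β γ : Type*} (S : Set (α × β × γ)) : Prop :=
  ∀ s ∈ S, ∀ t ∈ S, ∀ u ∈ S, s.1 = u.1 → s.2.1 = t.2.1 → t.2.2 = u.2.2 → s = t ∧ t = u

open Finset in
/-- The Ruzsa–Szemerédi construction. -/
theorem exists_isTriangleInduced (n : ℕ) :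
    ∃ S : Finset (ℕ × ℕ × ℕ), IsTriangleInduced (S : Set (ℕ × ℕ × ℕ)) ∧
      (∀ s ∈ S, s.1 < n ∧ s.2.1 < n ∧ s.2.2 < n) ∧
      #S = (n + 2) / 3 * rothNumberNat ((n + 2) / 3) := by
  classical
  obtain ⟨R, hR, hcard, hfree⟩ := rothNumberNat_spec ((n + 2) / 3)
  -- The differences `d, d'', d'` of a triangle form a progression in `R`, hence coincide. Rounding
  -- `n / 3` up still keeps `a + 2 * d` below `n`.
  let f : ℕ × ℕ → ℕ × ℕ × ℕ := fun v => (v.1, v.1 + v.2, v.1 + 2 * v.2)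
  have hf : f.Injective := by
    rintro ⟨a, b⟩ ⟨a', b'⟩ h
    simp only [f, Prod.mk.injEq] at h ⊢
    omega
  refine ⟨(range ((n + 2) / 3) ×ˢ R).image f, ?_, ?_, ?_⟩
  · rintro s hs t ht u hu h1 h2 h3
    simp only [coe_image, Set.mem_image, coe_product, Set.mem_prod] at hs ht hu
    obtain ⟨⟨a, d⟩, ⟨-, hd⟩, rfl⟩ := hs
    obtain ⟨⟨a', d'⟩, ⟨-, hd'⟩, rfl⟩ := ht
    obtain ⟨⟨a'', d''⟩, ⟨-, hd''⟩, rfl⟩ := hu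
    simp only [f] at h1 h2 h3 hd hd' hd''
    have hdd : d = d'' := hfree hd hd'' hd' (by omega)
    simp only [f, Prod.mk.injEq]
    omega
  · intro s hs
    obtain ⟨⟨a, d⟩, hv, rfl⟩ := mem_image.1 hs
    rw [mem_product] at hv
    have h1 := mem_range.1 hv.1
    have h2 := mem_range.1 (hR hv.2)
    simp only [f] at h1 h2 ⊢
    omega
  · rw [card_image_of_injective _ hf, card_product, card_range, hcard]

/-- A weak form of Behrend's bound. -/
theorem exists_mul_rpow_le_rothNumberNat (η : ℝ) (hη : 0 < η) :
    ∃ c : ℝ, 0 < c ∧ ∀ n : ℕ, 1 ≤ n → c * (n : ℝ) ^ (1 - η) ≤ rothNumberNat n := by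
  -- Completing the square gives `4 * √(log n) ≤ η * log n + 4 / η`, which absorbs Behrend's loss.
  refine ⟨Real.exp (-4 / η), Real.exp_pos _, fun n hn => ?_⟩
  have hn' : (1 : ℝ) ≤ n := by exact_mod_cast hn
  have hpos : (0 : ℝ) < n := by linarith
  refine le_trans ?_ Behrend.roth_lower_bound
  rw [sub_eq_add_neg, Real.rpow_add hpos, Real.rpow_one, mul_left_comm,
    Real.rpow_def_of_pos hpos, ← Real.exp_add]
  refine mul_le_mul_of_nonneg_left (Real.exp_le_exp.2 ?_) hpos.le
  have hL : 0 ≤ Real.log n := Real.log_nonneg hn'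
  have hs := Real.sq_sqrt hL
  set s := √(Real.log n)
  rw [← hs]
  have : 0 ≤ (η * s - 2) ^ 2 / η := by positivity
  have h2 : (η * s - 2) ^ 2 / η = η * s ^ 2 - 4 * s + 4 / η := by
    field_simp
    ring
  rw [neg_div]
  linarith

open Finset in
theorem exists_isTriangleInduced_card_ge (η : ℝ) (hη : 0 < η) (hη1 : η ≤ 1) :
    ∃ c : ℝ, 0 < c ∧ ∀ n : ℕ, 1 ≤ n →
      ∃ S : Finset (ℕ × ℕ × ℕ), IsTriangleInduced (S : Set (ℕ × ℕ × ℕ)) ∧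
        (∀ s ∈ S, s.1 < n ∧ s.2.1 < n ∧ s.2.2 < n) ∧ c * (n : ℝ) ^ (2 - η) ≤ #S := by
  obtain ⟨c, hc, h⟩ := exists_mul_rpow_le_rothNumberNat η hη
  refine ⟨c * (1 / 3) ^ (2 - η), by positivity, fun n hn => ?_⟩
  obtain ⟨S, h1, h2, h3⟩ := exists_isTriangleInduced n
  refine ⟨S, h1, h2, ?_⟩
  set m := (n + 2) / 3
  have hm : 1 ≤ m := by omega
  have hm0 : (0 : ℝ) < m := by exact_mod_cast hm
  have hnm : (1 / 3 : ℝ) * n ≤ m := by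
    have : n ≤ 3 * m := by omega
    have : (n : ℝ) ≤ 3 * m := by exact_mod_cast this
    linarith
  rw [h3, Nat.cast_mul, mul_assoc, ← Real.mul_rpow (by norm_num) (by positivity)]
  calc c * (1 / 3 * (n : ℝ)) ^ (2 - η) ≤ c * (m : ℝ) ^ (2 - η) := by
        refine mul_le_mul_of_nonneg_left ?_ hc.le
        exact Real.rpow_le_rpow (by positivity) hnm (by linarith)
    _ = m * (c * (m : ℝ) ^ (1 - η)) := by
        rw [show 2 - η = 1 + (1 - η) by ring, Real.rpow_add hm0, Real.rpow_one]
        ring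
    _ ≤ m * rothNumberNat m := mul_le_mul_of_nonneg_left (h m hm) hm0.le

/-! ### Operations on STPP constructions -/

namespace IsSTPP

variable {H ι : Type*} [AddCommGroup H] {A B C : ι → Finset H}

theorem comp_injective (h : IsSTPP A B C) {κ : Type*} {f : κ → ι} (hf : f.Injective) :
    IsSTPP (fun k => A (f k)) (fun k => B (f k)) (fun k => C (f k)) where
  tpp k := h.tpp (f k)
  simultaneous i j k a ha b hb b' hb' c hc c' hc' a' ha' h0 := by
    have := h.simultaneous _ _ _ a ha b hb b' hb' c hc c' hc' a' ha' h0
    exact ⟨hf this.1, hf this.2⟩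

theorem rotate (h : IsSTPP A B C) : IsSTPP B C A where
  tpp i b hb b' hb' c hc c' hc' a ha a' ha' := by
    have := h.tpp i a ha a' ha' b hb b' hb' c hc c' hc'
    rw [show b' - b + (c' - c) + (a' - a) = a' - a + (b' - b) + (c' - c) by abel, this]
    tauto
  simultaneous i j k b hb c hc c' hc' a ha a' ha' b' hb' h0 := by
    have := h.simultaneous k i j a' ha' b' hb' b hb c hc c' hc' a ha (by rw [← h0]; abel)
    exact ⟨this.2, this.2.symm.trans this.1.symm⟩

theorem prod (h : IsSTPP A B C) {H' ι' : Type*} [AddCommGroup H'] {A' B' C' : ι' → Finset H'}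
    (h' : IsSTPP A' B' C') :
    IsSTPP (fun i : ι × ι' => A i.1 ×ˢ A' i.2) (fun i => B i.1 ×ˢ B' i.2)
      (fun i => C i.1 ×ˢ C' i.2) where
  tpp i a ha a' ha' b hb b' hb' c hc c' hc' := by
    simp only [Finset.mem_product] at ha ha' hb hb' hc hc'
    have h1 := h.tpp i.1 _ ha.1 _ ha'.1 _ hb.1 _ hb'.1 _ hc.1 _ hc'.1
    have h2 := h'.tpp i.2 _ ha.2 _ ha'.2 _ hb.2 _ hb'.2 _ hc.2 _ hc'.2
    simp only [Prod.ext_iff, Prod.fst_add, Prod.snd_add, Prod.fst_sub, Prod.snd_sub, Prod.fst_zero,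
      Prod.snd_zero, h1, h2]
    tauto
  simultaneous i j k a ha b hb b' hb' c hc c' hc' a' ha' h0 := by
    simp only [Finset.mem_product] at ha ha' hb hb' hc hc'
    have h1 := h.simultaneous _ _ _ _ ha.1 _ hb.1 _ hb'.1 _ hc.1 _ hc'.1 _ ha'.1
      (congrArg Prod.fst h0)
    have h2 := h'.simultaneous _ _ _ _ ha.2 _ hb.2 _ hb'.2 _ hc.2 _ hc'.2 _ ha'.2
      (congrArg Prod.snd h0)
    exact ⟨Prod.ext h1.1 h2.1, Prod.ext h1.2 h2.2⟩

theorem pi (h : IsSTPP A B C) (κ : Type*) [Fintype κ] [DecidableEq κ] :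
    IsSTPP (fun i : κ → ι => Fintype.piFinset fun k => A (i k))
      (fun i => Fintype.piFinset fun k => B (i k))
      (fun i => Fintype.piFinset fun k => C (i k)) where
  tpp i a ha a' ha' b hb b' hb' c hc c' hc' := by
    simp only [Fintype.mem_piFinset] at ha ha' hb hb' hc hc'
    have h1 := fun k => h.tpp (i k) _ (ha k) _ (ha' k) _ (hb k) _ (hb' k) _ (hc k) _ (hc' k)
    simp only [funext_iff, Pi.add_apply, Pi.sub_apply, Pi.zero_apply, h1, forall_and]
  simultaneous i j k a ha b hb b' hb' c hc c' hc' a' ha' h0 := by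
    simp only [Fintype.mem_piFinset] at ha ha' hb hb' hc hc'
    have h1 := fun x => h.simultaneous _ _ _ _ (ha x) _ (hb x) _ (hb' x) _ (hc x) _ (hc' x) _ (ha' x)
      (congrFun h0 x)
    exact ⟨funext fun x => (h1 x).1, funext fun x => (h1 x).2⟩

/-- A uniform STPP construction together with a system of triples all of whose triangles are
trivial gives a tricolored sum-free set. -/
theorem exists_isTricoloredSumFree (h : IsSTPP A B C) {n : ℕ} (hA : ∀ i, (A i).card = n)
    (hB : ∀ i, (B i).card = n) (hC : ∀ i, (C i).card = n) {S : Finset (ℕ × ℕ × ℕ)}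
    (hS : IsTriangleInduced (S : Set (ℕ × ℕ × ℕ)))
    (hlt : ∀ s ∈ S, s.1 < n ∧ s.2.1 < n ∧ s.2.2 < n) :
    ∃ x y z : ι × S → H, IsTricoloredSumFree x y z := by
  let α i := ((A i).equivFinOfCardEq (hA i)).symm
  let β i := ((B i).equivFinOfCardEq (hB i)).symm
  let γ i := ((C i).equivFinOfCardEq (hC i)).symm
  let a : ι × S → H := fun s => α s.1 ⟨s.2.1.1, (hlt _ s.2.2).1⟩
  let b : ι × S → H := fun s => β s.1 ⟨s.2.1.2.1, (hlt _ s.2.2).2.1⟩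
  let c : ι × S → H := fun s => γ s.1 ⟨s.2.1.2.2, (hlt _ s.2.2).2.2⟩
  have ha : ∀ s, a s ∈ A s.1 := fun s => Subtype.prop _
  have hb : ∀ s, b s ∈ B s.1 := fun s => Subtype.prop _
  have hc : ∀ s, c s ∈ C s.1 := fun s => Subtype.prop _
  have habel : ∀ p q r s t u : H, (p - u) + (r - q) + (t - s) = (p - q) + (r - s) + (t - u) :=
    fun p q r s t u => by abel
  refine ⟨fun s => a s - b s, fun s => b s - c s, fun s => c s - a s, fun s t u =>
    ⟨fun h0 => ?_, ?_⟩⟩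
  · obtain ⟨h1, h2⟩ := h.simultaneous _ _ _ _ (ha s) _ (hb s) _ (hb t) _ (hc t) _ (hc u) _ (ha u) h0
    obtain ⟨i, s⟩ := s
    obtain ⟨j, t⟩ := t
    obtain ⟨k, u⟩ := u
    obtain rfl : i = j := h1
    obtain rfl : i = k := h2
    -- Regrouped into differences within `A i`, `B i`, `C i`, the relation forces equal coordinates,
    -- exactly a triangle in `S`.
    have h3 := (h.tpp i _ (ha (i, u)) _ (ha (i, s)) _ (hb (i, s)) _ (hb (i, t)) _ (hc (i, t)) _
      (hc (i, u))).1 ((habel _ _ _ _ _ _).trans h0)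
    simp only [sub_eq_zero, a, b, c, Subtype.coe_inj, EmbeddingLike.apply_eq_iff_eq,
      Fin.mk.injEq] at h3
    obtain ⟨h4, h5⟩ := hS _ s.2 _ t.2 _ u.2 h3.1 h3.2.1.symm h3.2.2.symm
    rw [Subtype.ext h4, Subtype.ext h5]
    exact ⟨rfl, rfl⟩
  · rintro ⟨rfl, rfl⟩
    exact (habel _ _ _ _ _ _).symm.trans (by simp)

end IsSTPP

/-! ### Type classes and the tensor power trick -/

open Finset in
/-- In the expansion of `(∑ i, X i) ^ N`, the indices of some fixed type carry at least a
polynomial fraction of the sum. -/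
theorem exists_type_class {ι : Type*} [Fintype ι] (X : ι → ℝ) (N : ℕ) :
    ∃ 𝒯 : Finset (Fin N → ι),
      (∑ i, X i) ^ N ≤ ((N : ℝ) + 1) ^ Fintype.card ι * ∑ I ∈ 𝒯, ∏ n, X (I n) ∧
      ∀ f : ι → ℕ, ∀ I ∈ 𝒯, ∀ J ∈ 𝒯, ∏ n, f (I n) = ∏ n, f (J n) := by
  classical
  -- The type of `I` counts occurrences of each index. It determines all the products, and there are
  -- only `(N + 1) ^ |ι|` candidates.
  let cnt : (Fin N → ι) → ι → Fin (N + 1) := fun I i =>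
    ⟨#{n | I n = i}, Nat.lt_succ_of_le ((card_le_univ _).trans (by simp))⟩
  obtain ⟨τ, -, hτ⟩ := exists_max_image (univ : Finset (ι → Fin (N + 1)))
    (fun τ => ∑ I with cnt I = τ, ∏ n, X (I n)) ⟨0, mem_univ _⟩
  refine ⟨({I | cnt I = τ} : Finset (Fin N → ι)), ?_, ?_⟩
  · have h1 : (∑ i, X i) ^ N = ∑ I : Fin N → ι, ∏ n, X (I n) := by
      rw [← Fintype.piFinset_univ, ← prod_univ_sum]
      simp
    rw [h1, ← sum_fiberwise univ cnt]
    refine (sum_le_card_nsmul _ _ _ fun τ' h => hτ τ' h).trans_eq ?_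
    simp
  · have h2 : ∀ f : ι → ℕ, ∀ I : Fin N → ι, ∏ n, f (I n) = ∏ i, f i ^ (cnt I i : ℕ) := by
      intro f I
      rw [← prod_fiberwise univ I]
      refine prod_congr rfl fun i _ => ?_
      rw [prod_congr rfl (g := fun _ => f i) fun n hn => by rw [(mem_filter.1 hn).2], prod_const]
    intro f I hI J hJ
    rw [h2, h2, (mem_filter.1 hI).2, (mem_filter.1 hJ).2]

theorem le_of_forall_pow_le_mul_pow {r K : ℝ} (k : ℕ)
    (h : ∀ N : ℕ, r ^ N ≤ K * ((N : ℝ) + 1) ^ k) : r ≤ 1 := by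
  by_contra! hr
  have hlim := ((tendsto_pow_const_div_const_pow_of_one_lt k hr).comp
    (Filter.tendsto_add_atTop_nat 1)).const_mul (K * r)
  rw [mul_zero] at hlim
  obtain ⟨N, hN⟩ := (hlim.eventually (gt_mem_nhds zero_lt_one)).exists
  have hrN : 0 < r ^ (N + 1) := by positivity
  simp only [Function.comp_apply] at hN
  rw [← mul_div_assoc, div_lt_one hrN, pow_succ] at hN
  push_cast at hN
  nlinarith [h N]

theorem exponent_triple_pi_le (H : Type*) [AddCommGroup H] [Finite H] (κ : Type*) :
    AddMonoid.exponent ((κ → H) × (κ → H) × (κ → H)) ≤ AddMonoid.exponent H := by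
  refine Nat.le_of_dvd (Nat.pos_of_ne_zero AddMonoid.exponent_ne_zero_of_finite)
    (AddMonoid.exponent_dvd_of_forall_nsmul_eq_zero fun g => ?_)
  have h : ∀ f : κ → H, AddMonoid.exponent H • f = 0 := fun f =>
    funext fun k => AddMonoid.exponent_nsmul_eq_zero (f k)
  exact Prod.ext (h _) (Prod.ext (h _) (h _))

open Finset in
/-- If tricolored sum-free sets in powers of `H` are small, an STPP construction satisfies the
inequality for some exponent larger than `2`, up to a polynomial factor in each power. -/
theorem IsSTPP.sum_rpow_pow_le.{u, v} {H : Type u} {ι : Type v} [AddCommGroup H] [Finite H] [Fintype ι]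
    {A B C : ι → Finset H} (h : IsSTPP A B C) {δ η c : ℝ} (hη : 0 < η) (hηδ : 2 * η ≤ δ)
    (hc : 0 < c) (N : ℕ)
    (hT : ∀ (T : Type v) [Fintype T]
      (x y z : T → (Fin N → H) × (Fin N → H) × (Fin N → H)), IsTricoloredSumFree x y z →
        (Fintype.card T : ℝ) ≤
          3 * (Nat.card ((Fin N → H) × (Fin N → H) × (Fin N → H)) : ℝ) ^ (1 - δ))
    (hS : ∀ n : ℕ, 1 ≤ n →
      ∃ S : Finset (ℕ × ℕ × ℕ), IsTriangleInduced (S : Set (ℕ × ℕ × ℕ)) ∧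
        (∀ s ∈ S, s.1 < n ∧ s.2.1 < n ∧ s.2.2 < n) ∧ c * (n : ℝ) ^ (2 - η) ≤ #S) :
    ((∑ i, ((#(A i) * #(B i) * #(C i) : ℕ) : ℝ) ^ ((2 + η) / 3)) ^ N) ^ 3 ≤
      (((N : ℝ) + 1) ^ Fintype.card ι) ^ 3 * (3 / c * ((Nat.card H : ℝ) ^ N) ^ 3) := by
  classical
  obtain ⟨𝒯, h𝒯, hconst⟩ := exists_type_class
    (fun i => ((#(A i) * #(B i) * #(C i) : ℕ) : ℝ) ^ ((2 + η) / 3)) N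
  have h0 : 0 ≤ (∑ i, ((#(A i) * #(B i) * #(C i) : ℕ) : ℝ) ^ ((2 + η) / 3)) ^ N :=
    pow_nonneg (sum_nonneg fun _ _ => Real.rpow_nonneg (Nat.cast_nonneg _) _) _
  rcases 𝒯.eq_empty_or_nonempty with rfl | ⟨I₀, hI₀⟩
  · rw [sum_empty, mul_zero] at h𝒯
    rw [le_antisymm h𝒯 h0, zero_pow three_ne_zero]
    positivity
  let G := (Fin N → H) × (Fin N → H) × (Fin N → H)
  set P := ∏ k, #(A (I₀ k))
  set Q := ∏ k, #(B (I₀ k))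
  set R := ∏ k, #(C (I₀ k))
  set n := P * Q * R with hn
  have hterm : ∀ I ∈ 𝒯, ∏ k, ((#(A (I k)) * #(B (I k)) * #(C (I k)) : ℕ) : ℝ) ^ ((2 + η) / 3) =
      (n : ℝ) ^ ((2 + η) / 3) := by
    intro I hI
    rw [Real.finsetProd_rpow _ _ fun i _ => Nat.cast_nonneg _, ← Nat.cast_prod,
      prod_mul_distrib, prod_mul_distrib, hconst (fun i => #(A i)) I hI I₀ hI₀,
      hconst (fun i => #(B i)) I hI I₀ hI₀, hconst (fun i => #(C i)) I hI I₀ hI₀]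
  rw [sum_congr rfl hterm, sum_const, nsmul_eq_mul] at h𝒯
  rcases Nat.eq_zero_or_pos n with hn0 | hn0
  · rw [hn0, Nat.cast_zero, Real.zero_rpow (by positivity), mul_zero, mul_zero] at h𝒯
    rw [le_antisymm h𝒯 h0, zero_pow three_ne_zero]
    positivity
  obtain ⟨S, hS1, hS2, hS3⟩ := hS n hn0
  have hsub := (h.pi (Fin N)).comp_injective (Subtype.val_injective (p := (· ∈ 𝒯)))
  -- The rotations balance the sizes: each of the three sets has size `P * Q * R`.
  have hG := hsub.prod (hsub.rotate.prod hsub.rotate.rotate)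
  have hcA : ∀ I : {I // I ∈ 𝒯}, #(Fintype.piFinset fun k => A (I.1 k)) = P := fun I => by
    rw [Fintype.card_piFinset, hconst (fun i => #(A i)) _ I.2 I₀ hI₀]
  have hcB : ∀ I : {I // I ∈ 𝒯}, #(Fintype.piFinset fun k => B (I.1 k)) = Q := fun I => by
    rw [Fintype.card_piFinset, hconst (fun i => #(B i)) _ I.2 I₀ hI₀]
  have hcC : ∀ I : {I // I ∈ 𝒯}, #(Fintype.piFinset fun k => C (I.1 k)) = R := fun I => by
    rw [Fintype.card_piFinset, hconst (fun i => #(C i)) _ I.2 I₀ hI₀]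
  obtain ⟨x, y, z, hxyz⟩ := hG.exists_isTricoloredSumFree (n := n)
    (fun i => by rw [card_product, card_product, hcA, hcB, hcC, hn]; ring)
    (fun i => by rw [card_product, card_product, hcA, hcB, hcC, hn]; ring)
    (fun i => by rw [card_product, card_product, hcA, hcB, hcC, hn]; ring) hS1 hS2
  have hbound := hT _ x y z hxyz
  have hnG : n ≤ Nat.card G := by
    have := Fintype.ofFinite G
    rw [Nat.card_eq_fintype_card]
    refine le_trans (le_of_eq ?_) (card_le_univ ((Fintype.piFinset fun k => A (I₀ k)) ×ˢ
      (Fintype.piFinset fun k => B (I₀ k)) ×ˢ (Fintype.piFinset fun k => C (I₀ k)) : Finset G))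
    rw [card_product, card_product, Fintype.card_piFinset, Fintype.card_piFinset,
      Fintype.card_piFinset, hn, mul_assoc]
  have hcardG : (Nat.card G : ℝ) = ((Nat.card H : ℝ) ^ N) ^ 3 := by
    simp only [G, Nat.card_prod, Nat.card_fun, Nat.card_fin]
    push_cast
    ring
  have hG1 : (1 : ℝ) ≤ Nat.card G := by exact_mod_cast Nat.card_pos
  have hG0 : (0 : ℝ) < Nat.card G := by linarith
  have hnpos : (0 : ℝ) < n := by exact_mod_cast hn0
  rw [Fintype.card_prod, Fintype.card_prod, Fintype.card_prod, Fintype.card_coe, Fintype.card_coe]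
    at hbound
  rw [← hcardG]
  refine (pow_le_pow_left₀ h0 h𝒯 3).trans ?_
  clear h0 h𝒯 hterm hconst
  clear_value n
  -- The first factor is controlled by the sum-free bound, the second by `n ≤ |G|`.
  have hpow : ((n : ℝ) ^ ((2 + η) / 3)) ^ 3 = (n : ℝ) ^ (2 - η) * (n : ℝ) ^ (2 * η) := by
    rw [← Real.rpow_natCast, ← Real.rpow_mul hnpos.le, ← Real.rpow_add hnpos]
    congr 1
    push_cast
    ring
  have h1 : (#𝒯 : ℝ) ^ 3 * (n : ℝ) ^ (2 - η) ≤ 3 / c * (Nat.card G : ℝ) ^ (1 - δ) := by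
    rw [div_mul_eq_mul_div, le_div_iff₀ hc]
    calc (#𝒯 : ℝ) ^ 3 * (n : ℝ) ^ (2 - η) * c = (#𝒯 : ℝ) ^ 3 * (c * (n : ℝ) ^ (2 - η)) := by ring
      _ ≤ (#𝒯 : ℝ) ^ 3 * #S := by gcongr
      _ = ((#𝒯 * (#𝒯 * #𝒯) * #S : ℕ) : ℝ) := by push_cast; ring
      _ ≤ _ := hbound
  have h2 : (n : ℝ) ^ (2 * η) ≤ (Nat.card G : ℝ) ^ δ :=
    (Real.rpow_le_rpow hnpos.le (by exact_mod_cast hnG) (by linarith)).trans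
      (Real.rpow_le_rpow_of_exponent_le hG1 hηδ)
  calc (((N : ℝ) + 1) ^ Fintype.card ι * (#𝒯 * (n : ℝ) ^ ((2 + η) / 3))) ^ 3 =
        (((N : ℝ) + 1) ^ Fintype.card ι) ^ 3 *
          ((#𝒯 : ℝ) ^ 3 * (n : ℝ) ^ (2 - η) * (n : ℝ) ^ (2 * η)) := by
            rw [mul_pow, mul_pow, hpow, mul_assoc ((#𝒯 : ℝ) ^ 3)]
    _ ≤ (((N : ℝ) + 1) ^ Fintype.card ι) ^ 3 *
        (3 / c * (Nat.card G : ℝ) ^ (1 - δ) * (Nat.card G : ℝ) ^ δ) := by gcongr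
    _ = _ := by rw [mul_assoc (3 / c), ← Real.rpow_add hG0, sub_add_cancel, Real.rpow_one]

/-- The `N`-th power bound loses only a polynomial in `N`, so the ratio of the two sides cannot
exceed `1`. Neither `δ` nor `c` depends on `H`, as the exponent of `H ^ (3N)` stays at most `l`. -/
theorem exists_stppInequality_of_exponent_le (l : ℕ) :
    ∃ η : ℝ, 0 < η ∧ ∀ (H : Type*) [AddCommGroup H] [Finite H], AddMonoid.exponent H ≤ l →
      ∀ (ι : Type*) [Fintype ι] (A B C : ι → Finset H), IsSTPP A B C →
        STPPInequality A B C (2 + η) := by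
  obtain ⟨δ, hδ, hT⟩ := exists_tricoloredSumFree_bound l
  have hη : 0 < min δ 1 / 2 := by positivity
  have hηδ : 2 * (min δ 1 / 2) ≤ δ := by linarith [min_le_left δ 1]
  obtain ⟨c, hc, hS⟩ := exists_isTriangleInduced_card_ge (min δ 1 / 2) hη
    (by linarith [min_le_right δ 1])
  refine ⟨min δ 1 / 2, hη, fun H _ _ hH ι _ A B C h => ?_⟩
  have hHpos : (0 : ℝ) < Nat.card H := by exact_mod_cast Nat.card_pos
  have key := fun N => h.sum_rpow_pow_le hη hηδ hc N
    (fun T _ x y z => hT _ ((exponent_triple_pi_le H (Fin N)).trans hH) T x y z) hS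
  unfold STPPInequality
  set s := ∑ i, (((A i).card * (B i).card * (C i).card : ℕ) : ℝ) ^ ((2 + min δ 1 / 2) / 3)
  have hs : 0 ≤ s := Finset.sum_nonneg fun _ _ => Real.rpow_nonneg (Nat.cast_nonneg _) _
  clear_value s
  have hle : (s / Nat.card H) ^ 3 ≤ 1 := by
    refine le_of_forall_pow_le_mul_pow (K := 3 / c) (Fintype.card ι * 3) fun N => ?_
    rw [← pow_mul, mul_comm 3 N, pow_mul, div_pow, div_pow, div_le_iff₀ (by positivity), pow_mul]
    refine (key N).trans_eq ?_
    ring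
  exact (div_le_one hHpos).1 ((pow_le_one_iff_of_nonneg (by positivity) (by norm_num)).1 hle)

theorem theoremB :
    ∀ ℓ : ℕ, ∃ ε : ℝ, 0 < ε ∧
      ∀ (H : Type*) [AddCommGroup H] [Finite H], AddMonoid.exponent H ≤ ℓ →
        ∀ (ι : Type*) [Fintype ι] (A B C : ι → Finset H), IsSTPP A B C →
          ¬ ∃ c : ℝ, c < 2 + ε ∧ YieldsOmegaBound A B C c := by
  intro l
  obtain ⟨η, hη, h⟩ := exists_stppInequality_of_exponent_le l
  refine ⟨η, hη, fun H _ _ hH ι _ A B C hS => ?_⟩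
  rintro ⟨c, hc, hyield⟩
  exact absurd (hyield (2 + η) (by linarith) (h H hH ι A B C hS)) (not_le.2 hc)
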